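/- Let $a>-1$, $|b|<1$ and $|b|<1+a$, let $\mathbb B(\cdot,\cdot)$ denote the Beta function, and let $B=(B_t)_{t\ge 0}$ be a weighted fractional Brownian motion with parameters $a,b$ on a probability space $(\Omega,\mathcal F,P)$, that is, a centred Gaussian process with $B_0=0$ a.s. and covariance $$E[B_tB_s]=\frac{1}{2\,\mathbb B(a+1,b+1)}\int_0^{s\wedge t}u^a\bigl((t-u)^b+(s-u)^b\bigr)\,du,\qquad s,t\ge 0 .$$ Assume that $B$ is measurable as a function of $(t,\omega)$, up to a null set of $dt\otimes P$ (for instance, that it has almost surely continuous paths). Put $$\kappa_{a,b}=\frac{1}{(1+b)\,\mathbb B(a+1,b+1)},\qquad X_\varepsilon(t)=\frac{1+a+b}{\varepsilon^{1+b}}\int_\varepsilon^{t+\varepsilon}(B_{s+\varepsilon}-B_s)^2s^b\,ds\qquad(\varepsilon>0,\ t\ge 0).$$ Then: (i) for every $t\ge 0$, $X_\varepsilon(t)\in L^2(\Omega)$ for all $\varepsilon>0$, and $X_\varepsilon(t)\to\kappa_{a,b}\,t^{1+a+b}$ in $L^2(\Omega)$ as $\varepsilon\downarrow 0$; (ii)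 the generalized quadratic covariation $[B,B]^{(a,b)}$ exists and $$[B,B]^{(a,b)}_t=\kappa_{a,b}\,t^{1+a+b},\qquad t\ge 0 .$$ Here, for a Borel function $f$, $[f(B),B]^{(a,b)}_t$ is the limit as $\varepsilon\downarrow0$ of $$J_\varepsilon(f,t)=\frac{1+a+b}{\varepsilon^{1+b}}\int_\varepsilon^{t+\varepsilon}\bigl(f(B_{s+\varepsilon})-f(B_s)\bigr)(B_{s+\varepsilon}-B_s)\,s^b\,ds,$$ provided that for each $\varepsilon>0$ these integrals exist almost surely for all $t\ge0$ and that the limit exists uniformly in probability, i.e. $\sup_{0\le t\le T}|J_\varepsilon(f,t)-[f(B),B]^{(a,b)}_t|\to0$ in probability for every $T\ge 0$; and $[B,B]^{(a,b)}$ is the case $f(x)=x$. -/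

import Mathlib

open MeasureTheory ProbabilityTheory Filter Topology
open scoped ENNReal NNReal

namespace WeightedFBm

/-- The covariance function of the weighted fractional Brownian motion with parameters `a`, `b`:
`R(t, s) = 1 / (2 𝔹(a+1, b+1)) ∫₀^{s ∧ t} u^a ((t - u)^b + (s - u)^b) du`.
Here `ProbabilityTheory.beta` is Euler's Beta function. -/
noncomputable def covariance (a b t s : ℝ) : ℝ :=
  1 / (2 * ProbabilityTheory.beta (a + 1) (b + 1)) *
    ∫ u in (0 : ℝ)..(min s t), u ^ a * ((t - u) ^ b + (s - u) ^ b)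

/-- `κ_{a,b} = 1 / ((1 + b) 𝔹(a+1, b+1))`. -/
noncomputable def kappa (a b : ℝ) : ℝ :=
  1 / ((1 + b) * ProbabilityTheory.beta (a + 1) (b + 1))

/-- `B` is a weighted fractional Brownian motion with parameters `a`, `b` under `P`: a centred
Gaussian process indexed by `t ≥ 0`, starting at `0`, with covariance function `covariance a b`.
The process is written as a function on all of `ℝ`, but only its values at times `t ≥ 0` are
constrained. -/
structure IsWeightedFBm {Ω : Type*} [MeasurableSpace Ω] (a b : ℝ) (P : Measure Ω)
    (B : ℝ → Ω → ℝ) : Prop where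
  gaussian : IsGaussianProcess (fun t : ℝ≥0 ↦ B (t : ℝ)) P
  start_zero : ∀ᵐ ω ∂P, B 0 ω = 0
  mean_zero : ∀ t : ℝ, 0 ≤ t → ∫ ω, B t ω ∂P = 0
  cov : ∀ t s : ℝ, 0 ≤ t → 0 ≤ s → ∫ ω, B t ω * B s ω ∂P = covariance a b t s

/-- The integrand `(f(B_{s+ε}) - f(B_s)) (B_{s+ε} - B_s) s^b`, as a function of `s`, along the
path indexed by `ω`. -/
noncomputable def integrand {Ω : Type*} (b : ℝ) (B : ℝ → Ω → ℝ) (f : ℝ → ℝ) (ε : ℝ) (ω : Ω)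
    (s : ℝ) : ℝ :=
  (f (B (s + ε) ω) - f (B s ω)) * (B (s + ε) ω - B s ω) * s ^ b

/-- `J_ε(f, t) = (1 + a + b) / ε^{1+b} ∫_ε^{t+ε} (f(B_{s+ε}) - f(B_s)) (B_{s+ε} - B_s) s^b ds`. -/
noncomputable def approx {Ω : Type*} (a b : ℝ) (B : ℝ → Ω → ℝ) (f : ℝ → ℝ) (ε t : ℝ) (ω : Ω) :
    ℝ :=
  (1 + a + b) / ε ^ (1 + b) * ∫ s in ε..(t + ε), integrand b B f ε ω s

/-- The process `V` is the generalized quadratic covariation `[f(B), B]^{(a,b)}`: almost surely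
the integrals defining `J_ε(f, t)` exist, and `J_ε(f, ·) → V` as `ε ↓ 0`, uniformly
(on compact time intervals) in probability. -/
structure IsGenQuadCov {Ω : Type*} [MeasurableSpace Ω] (a b : ℝ) (P : Measure Ω)
    (B : ℝ → Ω → ℝ) (f : ℝ → ℝ) (V : ℝ → Ω → ℝ) : Prop where
  integrable : ∀ ε : ℝ, 0 < ε → ∀ᵐ ω ∂P, ∀ t : ℝ, 0 ≤ t →
    IntervalIntegrable (integrand b B f ε ω) volume ε (t + ε)
  tendsto_ucp : ∀ T : ℝ, 0 ≤ T → ∀ δ : ℝ, 0 < δ →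
    Tendsto
      (fun ε : ℝ ↦
        P {ω | ENNReal.ofReal δ ≤ ⨆ t ∈ Set.Icc 0 T, ‖approx a b B f ε t ω - V t ω‖ₑ})
      (𝓝[>] 0) (𝓝 0)

/-- `X_ε(t) = (1 + a + b) / ε^{1+b} ∫_ε^{t+ε} (B_{s+ε} - B_s)^2 s^b ds`. -/
noncomputable def sqApprox {Ω : Type*} (a b : ℝ) (B : ℝ → Ω → ℝ) (ε t : ℝ) (ω : Ω) : ℝ :=
  (1 + a + b) / ε ^ (1 + b) * ∫ s in ε..(t + ε), (B (s + ε) ω - B s ω) ^ 2 * s ^ b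

end WeightedFBm

/-! Write `σ_ε(s, r)` for the covariance of the increments of `B` over `[s, s + ε]` and `[r, r + ε]`
(`incrementCov`), and split `X_ε(t)` into its mean and a centred part.

Mean: the covariance formula collapses to `σ_ε(s, s) = 𝔹(a+1, b+1)⁻¹ ∫_s^{s+ε} u^a (s + ε - u)^b
du`, which is asymptotic to `κ s^a ε^{1+b}`. The normalisation cancels `ε^{1+b}`, and the limit of
the mean is `(1 + a + b) κ ∫_0^t s^{a+b} ds = κ t^{1+a+b}` (`tendsto_meanApprox`).

Variance: by Isserlis' formula it is the double integral of `2 σ_ε(s, r)²` against the weights. Off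
the diagonal `σ_ε(s, r) = O(ε²) = o(ε^{1+b})`, because `b < 1` (`tendsto_incrementCov_of_ne`), so
the integrand tends to `0` almost everywhere. Cauchy–Schwarz, `σ_ε(s, r)² ≤ σ_ε(s, s) σ_ε(r, r)`,
dominates it by a multiple of `s^{a+b} r^{a+b}` on a bounded square, integrable since `1 + a + b >
0`. Dominated convergence then suffices, with no quantitative estimate near the diagonal
(`tendsto_integral_sq_integral_centred`).

Uniformity: `t ↦ X_ε(t)` is nondecreasing and the limit is continuous and deterministic, so
convergence in probability at each `t` upgrades to convergence uniform on compacts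
(`tendsto_measure_iSup_of_monotoneOn`). -/

namespace WeightedFBm

/-! ### Fourth-order moments of Gaussian variables -/

section Gaussian

/-- The fourth moment of a centred Gaussian law. -/
lemma integral_pow_four_gaussianReal (v : ℝ≥0) :
    ∫ x, x ^ 4 ∂(gaussianReal 0 v) = 3 * (v : ℝ) ^ 2 := by
  -- The fourth moment is the fourth derivative at `0` of the moment generating function `exp (v t²
  -- / 2)`, computed one derivative at a time.
  have hexp : ∀ p : ℝ, HasDerivAt (fun t : ℝ ↦ Real.exp (v * t ^ 2 / 2))
      (v * p * Real.exp (v * p ^ 2 / 2)) p := by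
    intro p
    have h := ((((hasDerivAt_id p).pow 2).const_mul (v : ℝ)).div_const 2).exp
    convert! h using 1
    simp
    ring
  have hmgf : mgf id (gaussianReal 0 v) = fun t ↦ Real.exp (v * t ^ 2 / 2) := by
    rw [mgf_id_gaussianReal]; simp
  have h1 : deriv (fun t : ℝ ↦ Real.exp (v * t ^ 2 / 2)) =
      fun p ↦ v * p * Real.exp (v * p ^ 2 / 2) := funext fun p ↦ (hexp p).deriv
  have h2 : deriv (fun p : ℝ ↦ v * p * Real.exp (v * p ^ 2 / 2)) =
      fun p ↦ (v + v ^ 2 * p ^ 2) * Real.exp (v * p ^ 2 / 2) := by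
    funext p
    have h := ((hasDerivAt_id p).const_mul (v : ℝ)).mul (hexp p)
    refine HasDerivAt.deriv ?_
    convert! h using 1
    simp
    ring
  have h3 : deriv (fun p : ℝ ↦ (v + v ^ 2 * p ^ 2) * Real.exp (v * p ^ 2 / 2)) =
      fun p ↦ (3 * v ^ 2 * p + v ^ 3 * p ^ 3) * Real.exp (v * p ^ 2 / 2) := by
    funext p
    have h := ((((hasDerivAt_id p).pow 2).const_mul ((v : ℝ) ^ 2)).const_add (v : ℝ)).mul (hexp p)
    refine HasDerivAt.deriv ?_
    convert! h using 1
    simp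
    ring
  have h4 : deriv (fun p : ℝ ↦ (3 * v ^ 2 * p + v ^ 3 * p ^ 3) * Real.exp (v * p ^ 2 / 2)) 0 =
      3 * (v : ℝ) ^ 2 := by
    have h := (((hasDerivAt_id (0 : ℝ)).const_mul (3 * (v : ℝ) ^ 2)).add
      (((hasDerivAt_id (0 : ℝ)).pow 3).const_mul ((v : ℝ) ^ 3))).mul (hexp 0)
    refine HasDerivAt.deriv ?_
    convert! h using 1
    simp
  have hset : integrableExpSet id (gaussianReal 0 v) = Set.univ := by
    simp [integrableExpSet_id_gaussianReal]
  have key := iteratedDeriv_mgf_zero (X := id) (μ := gaussianReal 0 v) (by simp [hset]) 4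
  rw [hmgf] at key
  simp only [iteratedDeriv_succ', iteratedDeriv_zero] at key
  rw [h1, h2, h3, h4] at key
  rw [key]
  simp

variable {Ω : Type*} [MeasurableSpace Ω] {P : Measure Ω} {U V : Ω → ℝ}

lemma integral_pow_four_of_hasGaussianLaw (h : HasGaussianLaw U P) (h0 : ∫ ω, U ω ∂P = 0) :
    ∫ ω, U ω ^ 4 ∂P = 3 * (∫ ω, U ω ^ 2 ∂P) ^ 2 := by
  have hlaw := h.map_eq_gaussianReal
  have hvar : Var[U; P] = ∫ ω, U ω ^ 2 ∂P := by
    rw [variance_eq_integral h.aemeasurable, h0]; simp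
  have hnn : 0 ≤ ∫ ω, U ω ^ 2 ∂P := integral_nonneg fun ω ↦ sq_nonneg _
  have h1 : ∫ x, x ^ 4 ∂(P.map U) = ∫ ω, U ω ^ 4 ∂P :=
    integral_map h.aemeasurable (by fun_prop)
  rw [← h1, hlaw, h0, integral_pow_four_gaussianReal, hvar, Real.coe_toNNReal _ hnn]

/-- Isserlis' formula for the covariance of the squares of two centred Gaussian variables. -/
lemma integral_sq_mul_sq (hUV : HasGaussianLaw (fun ω ↦ (U ω, V ω)) P)
    (hU : ∫ ω, U ω ∂P = 0) (hV : ∫ ω, V ω ∂P = 0) :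
    Integrable (fun ω ↦ U ω ^ 2 * V ω ^ 2) P ∧
    ∫ ω, U ω ^ 2 * V ω ^ 2 ∂P =
      (∫ ω, U ω ^ 2 ∂P) * (∫ ω, V ω ^ 2 ∂P) + 2 * (∫ ω, U ω * V ω ∂P) ^ 2 := by
  have gU := hUV.fst
  have gV := hUV.snd
  have gA := hUV.fun_add
  have gS := hUV.fun_sub
  have i4 : ∀ {X : Ω → ℝ}, HasGaussianLaw X P → Integrable (fun ω ↦ X ω ^ 4) P := by
    intro X hX
    have := (hX.memLp (p := 4) (by norm_num)).integrable_norm_pow (by norm_num)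
    refine this.congr (ae_of_all _ fun ω ↦ ?_)
    simp only [Real.norm_eq_abs]
    exact Even.pow_abs (by decide) _
  have i2U : Integrable (fun ω ↦ U ω ^ 2) P := gU.memLp_two.integrable_sq
  have i2V : Integrable (fun ω ↦ V ω ^ 2) P := gV.memLp_two.integrable_sq
  have iUV : Integrable (fun ω ↦ U ω * V ω) P := gU.memLp_two.integrable_mul gV.memLp_two
  have e4 := integral_pow_four_of_hasGaussianLaw gU hU
  have f4 := integral_pow_four_of_hasGaussianLaw gV hV
  have a4 := integral_pow_four_of_hasGaussianLaw gA
    (by rw [integral_add gU.integrable gV.integrable, hU, hV, add_zero])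
  have s4 := integral_pow_four_of_hasGaussianLaw gS
    (by rw [integral_sub gU.integrable gV.integrable, hU, hV, sub_zero])
  have ea : ∫ ω, (U ω + V ω) ^ 2 ∂P =
      ∫ ω, U ω ^ 2 ∂P + ∫ ω, V ω ^ 2 ∂P + 2 * ∫ ω, U ω * V ω ∂P := by
    rw [← integral_const_mul, ← integral_add i2U i2V,
      ← integral_add (i2U.fun_add i2V) (iUV.const_mul 2)]
    exact integral_congr_ae (ae_of_all _ fun ω ↦ by simp; ring)
  have es : ∫ ω, (U ω - V ω) ^ 2 ∂P =
      ∫ ω, U ω ^ 2 ∂P + ∫ ω, V ω ^ 2 ∂P - 2 * ∫ ω, U ω * V ω ∂P := by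
    rw [← integral_const_mul, ← integral_add i2U i2V,
      ← integral_sub (i2U.fun_add i2V) (iUV.const_mul 2)]
    exact integral_congr_ae (ae_of_all _ fun ω ↦ by simp; ring)
  -- Polarisation reduces the mixed moment to fourth moments of the Gaussian variables `U`, `V`, `U
  -- + V` and `U - V`.
  have hpt : (fun ω ↦ U ω ^ 2 * V ω ^ 2) = fun ω ↦ 1 / 12 * (((U ω + V ω) ^ 4 + (U ω - V ω) ^ 4) -
      2 * (U ω ^ 4 + V ω ^ 4)) := by
    funext ω; ring
  have iA := i4 gA
  have iS := i4 gS
  have iU := i4 gU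
  have iV := i4 gV
  rw [hpt]
  refine ⟨((iA.fun_add iS).sub' ((iU.fun_add iV).const_mul 2)).const_mul (1 / 12), ?_⟩
  rw [integral_const_mul, integral_sub (iA.fun_add iS) ((iU.fun_add iV).const_mul 2),
    integral_add iA iS, integral_const_mul, integral_add iU iV, e4, f4, a4, s4, ea, es]
  ring

lemma integral_centred_sq_mul_sq [IsProbabilityMeasure P]
    (hUV : HasGaussianLaw (fun ω ↦ (U ω, V ω)) P)
    (hU : ∫ ω, U ω ∂P = 0) (hV : ∫ ω, V ω ∂P = 0) :
    ∫ ω, (U ω ^ 2 - ∫ ω, U ω ^ 2 ∂P) * (V ω ^ 2 - ∫ ω, V ω ^ 2 ∂P) ∂P =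
      2 * (∫ ω, U ω * V ω ∂P) ^ 2 := by
  obtain ⟨hi, he⟩ := integral_sq_mul_sq hUV hU hV
  set u := ∫ ω, U ω ^ 2 ∂P with hu
  set v := ∫ ω, V ω ^ 2 ∂P with hv
  have i2U : Integrable (fun ω ↦ U ω ^ 2) P := hUV.fst.memLp_two.integrable_sq
  have i2V : Integrable (fun ω ↦ V ω ^ 2) P := hUV.snd.memLp_two.integrable_sq
  have hpt : ∀ ω, (U ω ^ 2 - u) * (V ω ^ 2 - v) =
      U ω ^ 2 * V ω ^ 2 - v * U ω ^ 2 - u * V ω ^ 2 + u * v := fun ω ↦ by ring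
  simp_rw [hpt]
  rw [integral_add ((hi.sub' (i2U.const_mul v)).sub' (i2V.const_mul u)) (integrable_const _),
    integral_sub (hi.sub' (i2U.const_mul v)) (i2V.const_mul u),
    integral_sub hi (i2U.const_mul v), integral_const_mul, integral_const_mul, he, ← hu, ← hv]
  simp
  ring

/-- The Cauchy–Schwarz inequality for square integrable functions. -/
lemma sq_integral_mul_le (hU : MemLp U 2 P) (hV : MemLp V 2 P) :
    (∫ ω, U ω * V ω ∂P) ^ 2 ≤ (∫ ω, U ω ^ 2 ∂P) * ∫ ω, V ω ^ 2 ∂P := by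
  have iU := hU.integrable_sq
  have iV := hV.integrable_sq
  have iUV : Integrable (fun ω ↦ U ω * V ω) P := hU.integrable_mul hV
  -- The quadratic `x ↦ E[(x V + U)²]` is nonnegative, so its discriminant is at most `0`.
  have h : ∀ x : ℝ, 0 ≤ (∫ ω, V ω ^ 2 ∂P) * (x * x) + (2 * ∫ ω, U ω * V ω ∂P) * x +
      ∫ ω, U ω ^ 2 ∂P := by
    intro x
    have : (∫ ω, V ω ^ 2 ∂P) * (x * x) + (2 * ∫ ω, U ω * V ω ∂P) * x + ∫ ω, U ω ^ 2 ∂P =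
        ∫ ω, (x * V ω + U ω) ^ 2 ∂P := by
      have e : ∀ ω, (x * V ω + U ω) ^ 2 = x * x * V ω ^ 2 + 2 * x * (U ω * V ω) + U ω ^ 2 :=
        fun ω ↦ by ring
      simp_rw [e]
      rw [integral_add ((iV.const_mul _).fun_add (iUV.const_mul _)) iU,
        integral_add (iV.const_mul _) (iUV.const_mul _), integral_const_mul, integral_const_mul]
      ring
    rw [this]
    exact integral_nonneg fun ω ↦ sq_nonneg _
  have := discrim_le_zero h
  rw [discrim] at this
  nlinarith

end Gaussian

/-! ### Covariances of increments: exact formulas and small-`ε` asymptotics -/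

section Covariance

variable {a b : ℝ}

lemma intervalIntegrable_rpow_mul_rpow_sub (ha : -1 < a) (hb : -1 < b) {s t : ℝ} (hs : 0 ≤ s)
    (hst : s ≤ t) : IntervalIntegrable (fun u : ℝ ↦ u ^ a * (t - u) ^ b) volume 0 s := by
  rcases hs.eq_or_lt with rfl | hs0
  · exact IntervalIntegrable.refl
  have ht : 0 < t := hs0.trans_le hst
  have hfull : IntervalIntegrable (fun u : ℝ ↦ u ^ a * (t - u) ^ b) volume 0 t := by
    -- The possible singularities sit at `0` (from `u ^ a`) and at `t` (from `(t - u) ^ b`).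
    -- Splitting at `t / 2` leaves one on each half, with the other factor continuous there.
    refine IntervalIntegrable.trans (b := t / 2) ?_ ?_
    · refine (intervalIntegral.intervalIntegrable_rpow' ha).mul_continuousOn ?_
      refine ContinuousOn.rpow_const (by fun_prop) fun u hu ↦ Or.inl ?_
      rw [Set.uIcc_of_le (by linarith)] at hu
      have := hu.2
      intro h; linarith
    · have h := (intervalIntegral.intervalIntegrable_rpow' (a := t / 2) (b := 0) hb).comp_sub_left t
      rw [sub_zero, sub_half] at h
      refine h.continuousOn_mul ?_
      refine ContinuousOn.rpow_const (by fun_prop) fun u hu ↦ Or.inl ?_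
      rw [Set.uIcc_of_le (by linarith)] at hu
      have := hu.1
      intro h; linarith
  refine hfull.mono_set ?_
  rw [Set.uIcc_of_le hs, Set.uIcc_of_le ht.le]
  exact Set.Icc_subset_Icc_right hst

lemma intervalIntegrable_rpow_mul_rpow_sub' (ha : -1 < a) (hb : -1 < b) {r s t : ℝ} (hr : 0 ≤ r)
    (hrs : r ≤ s) (hst : s ≤ t) :
    IntervalIntegrable (fun u : ℝ ↦ u ^ a * (t - u) ^ b) volume r s :=
  (intervalIntegrable_rpow_mul_rpow_sub ha hb (hr.trans hrs) hst).mono_set (by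
    rw [Set.uIcc_of_le hrs, Set.uIcc_of_le (hr.trans hrs)]
    exact Set.Icc_subset_Icc_left hr)

lemma covariance_comm (t s : ℝ) : covariance a b t s = covariance a b s t := by
  simp only [covariance, min_comm t s, add_comm]

lemma covariance_of_le (ha : -1 < a) (hb : -1 < b) {s t : ℝ} (hs : 0 ≤ s) (hst : s ≤ t) :
    covariance a b t s = 1 / (2 * beta (a + 1) (b + 1)) *
      ((∫ u in (0 : ℝ)..s, u ^ a * (t - u) ^ b) + ∫ u in (0 : ℝ)..s, u ^ a * (s - u) ^ b) := by
  rw [covariance, min_eq_left hst, ← intervalIntegral.integral_add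
    (intervalIntegrable_rpow_mul_rpow_sub ha hb hs hst)
    (intervalIntegrable_rpow_mul_rpow_sub ha hb hs le_rfl)]
  simp_rw [mul_add]

/-- The covariance of the increments over `[s, s + ε]` and `[r, r + ε]`. -/
noncomputable def incrementCov (a b ε s r : ℝ) : ℝ :=
  covariance a b (s + ε) (r + ε) - covariance a b (s + ε) r - covariance a b s (r + ε) +
    covariance a b s r

lemma incrementCov_comm (ε s r : ℝ) : incrementCov a b ε s r = incrementCov a b ε r s := by
  simp only [incrementCov, covariance_comm s r, covariance_comm (s + ε) r,
    covariance_comm s (r + ε), covariance_comm (s + ε) (r + ε)]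
  ring

/-- All contributions from `[0, s]` cancel in the second difference; only the new interval `[s, s +
ε]` remains. -/
lemma incrementCov_self (ha : -1 < a) (hb : -1 < b) {ε s : ℝ} (hε : 0 ≤ ε) (hs : 0 ≤ s) :
    incrementCov a b ε s s = 1 / beta (a + 1) (b + 1) *
      ∫ u in s..(s + ε), u ^ a * (s + ε - u) ^ b := by
  have hsε : s ≤ s + ε := by linarith
  rw [incrementCov, covariance_comm s (s + ε), covariance_of_le ha hb (hs.trans hsε) le_rfl,
    covariance_of_le ha hb hs hsε, covariance_of_le ha hb hs le_rfl,
    ← intervalIntegral.integral_add_adjacent_intervals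
      (intervalIntegrable_rpow_mul_rpow_sub ha hb hs hsε)
      (intervalIntegrable_rpow_mul_rpow_sub' ha hb hs hsε le_rfl),
    one_div_mul_eq_div, one_div_mul_eq_div, one_div_mul_eq_div, one_div_mul_eq_div]
  have := beta_pos (by linarith : 0 < a + 1) (by linarith : 0 < b + 1)
  field_simp
  ring

/-- For non-overlapping intervals the terms involving only the smaller time cancel, and so do the
integrals over `[0, r]` of the others. What remains is a difference of powers, small when `s - r` is
bounded below. -/
lemma incrementCov_of_add_le (ha : -1 < a) (hb : -1 < b) {ε r s : ℝ} (hε : 0 ≤ ε) (hr : 0 ≤ r)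
    (hrs : r + ε ≤ s) :
    incrementCov a b ε s r = 1 / (2 * beta (a + 1) (b + 1)) *
      ∫ u in r..(r + ε), u ^ a * ((s + ε - u) ^ b - (s - u) ^ b) := by
  have h1 : r ≤ r + ε := by linarith
  have h2 : 0 ≤ r + ε := by linarith
  have h3 : r + ε ≤ s + ε := by linarith
  have e1 := intervalIntegral.integral_add_adjacent_intervals
      (intervalIntegrable_rpow_mul_rpow_sub ha hb hr (by linarith : r ≤ s + ε))
      (intervalIntegrable_rpow_mul_rpow_sub' ha hb hr h1 h3)
  have e2 := intervalIntegral.integral_add_adjacent_intervals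
      (intervalIntegrable_rpow_mul_rpow_sub ha hb hr (by linarith : r ≤ s))
      (intervalIntegrable_rpow_mul_rpow_sub' ha hb hr h1 hrs)
  rw [incrementCov, covariance_of_le ha hb h2 h3, covariance_of_le ha hb hr (by linarith),
    covariance_of_le ha hb h2 hrs, covariance_of_le ha hb hr (by linarith), ← e1, ← e2]
  simp_rw [mul_sub]
  rw [intervalIntegral.integral_sub (intervalIntegrable_rpow_mul_rpow_sub' ha hb hr h1 h3)
    (intervalIntegrable_rpow_mul_rpow_sub' ha hb hr h1 hrs)]
  ring

lemma integral_rpow_sub (hb : -1 < b) (ε s : ℝ) :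
    ∫ u in s..(s + ε), (s + ε - u) ^ b = ε ^ (1 + b) / (1 + b) := by
  rw [intervalIntegral.integral_comp_sub_left (fun x : ℝ ↦ x ^ b), integral_rpow (Or.inl hb)]
  have : 1 + b ≠ 0 := by linarith
  simp [Real.zero_rpow this, add_comm b]

lemma intervalIntegrable_rpow_sub (hb : -1 < b) (ε s : ℝ) :
    IntervalIntegrable (fun u : ℝ ↦ (s + ε - u) ^ b) volume s (s + ε) := by
  have h := (intervalIntegral.intervalIntegrable_rpow' (a := ε) (b := 0) hb).comp_sub_left (s + ε)
  simpa using h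

lemma kappa_eq : kappa a b = 1 / beta (a + 1) (b + 1) / (1 + b) := by
  rw [kappa, div_div, mul_comm]

lemma rpow_le_two_rpow_abs_mul {s u : ℝ} (hs : 0 < s) (h1 : s ≤ u) (h2 : u ≤ 2 * s) :
    u ^ a ≤ 2 ^ |a| * s ^ a := by
  have hu : u = u / s * s := by field_simp
  have h3 : 1 ≤ u / s := (one_le_div hs).2 h1
  have h4 : u / s ≤ 2 := (div_le_iff₀ hs).2 h2
  rw [hu, Real.mul_rpow (by linarith) hs.le]
  gcongr
  exact (Real.rpow_le_rpow_of_exponent_le h3 (le_abs_self a)).trans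
    (Real.rpow_le_rpow (by linarith) h4 (abs_nonneg a))

lemma incrementCov_self_nonneg (ha : -1 < a) (hb : -1 < b) {ε s : ℝ} (hε : 0 ≤ ε) (hs : 0 ≤ s) :
    0 ≤ incrementCov a b ε s s := by
  rw [incrementCov_self ha hb hε hs]
  have := beta_pos (by linarith : 0 < a + 1) (by linarith : 0 < b + 1)
  refine mul_nonneg (by positivity) (intervalIntegral.integral_nonneg (by linarith) fun u hu ↦ ?_)
  exact mul_nonneg (Real.rpow_nonneg (hs.trans hu.1) _) (Real.rpow_nonneg (sub_nonneg.2 hu.2) _)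

/-- The condition `ε ≤ s` gives `[s, s + ε] ⊆ [s, 2s]`, where `u ^ a` is at most `2 ^ |a| * s ^ a`
whatever the sign of `a`. This is where starting the integrals at `ε` rather than `0` is used. -/
lemma incrementCov_self_le (ha : -1 < a) (hb : -1 < b) {ε s : ℝ} (hε : 0 < ε) (hs : ε ≤ s) :
    incrementCov a b ε s s ≤ kappa a b * 2 ^ |a| * s ^ a * ε ^ (1 + b) := by
  have hs0 : 0 < s := hε.trans_le hs
  have hβ := beta_pos (by linarith : 0 < a + 1) (by linarith : 0 < b + 1)
  rw [incrementCov_self ha hb hε.le hs0.le]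
  calc _ ≤ 1 / beta (a + 1) (b + 1) *
        ∫ u in s..(s + ε), 2 ^ |a| * s ^ a * (s + ε - u) ^ b := by
        gcongr
        refine intervalIntegral.integral_mono_on (by linarith)
          (intervalIntegrable_rpow_mul_rpow_sub' ha hb hs0.le (by linarith) le_rfl)
          ((intervalIntegrable_rpow_sub hb ε s).const_mul _) fun u hu ↦ ?_
        refine mul_le_mul_of_nonneg_right ?_ (Real.rpow_nonneg (sub_nonneg.2 hu.2) _)
        exact rpow_le_two_rpow_abs_mul hs0 hu.1 (hu.2.trans (by linarith))
    _ = _ := by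
        rw [intervalIntegral.integral_const_mul, integral_rpow_sub hb, kappa_eq]
        ring

/-- By continuity of `u ^ a` at `s > 0`, the factor may be frozen at `s ^ a`; the remaining integral
is exactly `ε ^ (1 + b) / (1 + b)`. -/
lemma tendsto_incrementCov_self (ha : -1 < a) (hb : -1 < b) {s : ℝ} (hs : 0 < s) :
    Tendsto (fun ε ↦ incrementCov a b ε s s / ε ^ (1 + b)) (𝓝[>] 0) (𝓝 (kappa a b * s ^ a)) := by
  have hβ := beta_pos (by linarith : 0 < a + 1) (by linarith : 0 < b + 1)
  have hb1 : 0 < 1 + b := by linarith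
  have hκ : 0 < kappa a b := by rw [kappa_eq]; positivity
  rw [Metric.tendsto_nhds]
  intro η hη
  -- The error in `u ^ a` gets multiplied by `kappa a b`, so this tolerance yields a final error of
  -- `η / 2`.
  have hη' : 0 < η / (2 * kappa a b) := by positivity
  obtain ⟨δ, hδ, hcont⟩ := Metric.continuousAt_iff.1
    (Real.continuousAt_rpow_const s a (Or.inl hs.ne')) _ hη'
  filter_upwards [Ioo_mem_nhdsGT hδ] with ε hε
  have hε0 : 0 < ε := hε.1
  have hI := intervalIntegrable_rpow_mul_rpow_sub' ha hb hs.le (by linarith : s ≤ s + ε) le_rfl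
  have hJ := intervalIntegrable_rpow_sub hb ε s
  have hbound : |(∫ u in s..(s + ε), u ^ a * (s + ε - u) ^ b) - s ^ a * (ε ^ (1 + b) / (1 + b))| ≤
      η / (2 * kappa a b) * (ε ^ (1 + b) / (1 + b)) := by
    rw [← integral_rpow_sub hb ε s, ← intervalIntegral.integral_const_mul,
      ← intervalIntegral.integral_const_mul, ← intervalIntegral.integral_sub hI (hJ.const_mul _)]
    rw [← Real.norm_eq_abs]
    refine intervalIntegral.norm_integral_le_of_norm_le (by linarith) (ae_of_all _ fun u hu ↦ ?_)
      (hJ.const_mul _)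
    have hnn : 0 ≤ (s + ε - u) ^ b := Real.rpow_nonneg (sub_nonneg.2 hu.2) _
    rw [← sub_mul, norm_mul, Real.norm_of_nonneg hnn]
    refine mul_le_mul_of_nonneg_right ?_ hnn
    refine (hcont (x := u) ?_).le
    rw [Real.dist_eq, abs_lt]
    constructor <;> linarith [hu.1, hu.2, hε.2]
  have hpos : 0 < ε ^ (1 + b) := Real.rpow_pos_of_pos hε0 _
  rw [Real.dist_eq, incrementCov_self ha hb hε0.le hs.le]
  set I := ∫ u in s..(s + ε), u ^ a * (s + ε - u) ^ b
  have e : 1 / beta (a + 1) (b + 1) * I / ε ^ (1 + b) - kappa a b * s ^ a =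
      1 / beta (a + 1) (b + 1) / ε ^ (1 + b) * (I - s ^ a * (ε ^ (1 + b) / (1 + b))) := by
    rw [kappa_eq]; field_simp
  rw [e, abs_mul, abs_of_pos (by positivity)]
  calc _ ≤ 1 / beta (a + 1) (b + 1) / ε ^ (1 + b) *
        (η / (2 * kappa a b) * (ε ^ (1 + b) / (1 + b))) := by gcongr
    _ = η / 2 := by rw [kappa_eq]; field_simp
    _ < η := by linarith

lemma abs_rpow_add_sub_rpow_le (hb : b < 1) {d x ε : ℝ} (hd : 0 < d) (hx : d ≤ x) (hε : 0 ≤ ε) :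
    |(x + ε) ^ b - x ^ b| ≤ |b| * d ^ (b - 1) * ε := by
  have h := norm_image_sub_le_of_norm_deriv_le_segment' (f := fun y : ℝ ↦ y ^ b)
    (f' := fun y ↦ b * y ^ (b - 1)) (a := x) (b := x + ε) (C := |b| * d ^ (b - 1))
    (fun y hy ↦ (Real.hasDerivAt_rpow_const
      (Or.inl (by linarith [hy.1] : (0 : ℝ) < y).ne')).hasDerivWithinAt)
    (fun y hy ↦ by
      have hdy : d ≤ y := hx.trans hy.1
      rw [norm_mul, Real.norm_eq_abs, Real.norm_of_nonneg (Real.rpow_nonneg (hd.le.trans hdy) _)]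
      exact mul_le_mul_of_nonneg_left
        (Real.rpow_le_rpow_of_nonpos hd hdy (by linarith)) (abs_nonneg _))
    (x + ε) (Set.right_mem_Icc.2 (by linarith))
  simpa using h

/-- Away from the diagonal, the difference of powers is `O(ε)` and is integrated over an interval of
length `ε`. Dividing `O(ε²)` by `ε ^ (1 + b)` leaves `ε ^ (1 - b)`. -/
lemma tendsto_incrementCov_of_lt (ha : -1 < a) (hb : -1 < b) (hb1 : b < 1) {r s : ℝ} (hr : 0 < r)
    (hrs : r < s) :
    Tendsto (fun ε ↦ incrementCov a b ε s r / ε ^ (1 + b)) (𝓝[>] 0) (𝓝 0) := by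
  have hβ := beta_pos (by linarith : 0 < a + 1) (by linarith : 0 < b + 1)
  set d := (s - r) / 2 with hd
  have hd0 : 0 < d := by rw [hd]; linarith
  set M := 1 / (2 * beta (a + 1) (b + 1)) * (2 ^ |a| * r ^ a * (|b| * d ^ (b - 1)))
  have hlim : Tendsto (fun ε : ℝ ↦ M * ε ^ (1 - b)) (𝓝[>] 0) (𝓝 0) := by
    have h : Tendsto (fun ε : ℝ ↦ ε ^ (1 - b)) (𝓝 0) (𝓝 0) := by
      have := (Real.continuousAt_rpow_const 0 (1 - b) (Or.inr (by linarith))).tendsto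
      rwa [Real.zero_rpow (by linarith)] at this
    simpa using (h.mono_left nhdsWithin_le_nhds).const_mul M
  refine squeeze_zero_norm' ?_ hlim
  -- For `u ∈ [r, r + ε]`, `ε < r` gives `u ≤ 2 * r`, and `ε < d` gives `s - u ≥ d`.
  filter_upwards [Ioo_mem_nhdsGT (lt_min hr hd0)] with ε hε
  have hε0 : 0 < ε := hε.1
  have hεr : ε < r := hε.2.trans_le (min_le_left _ _)
  have hεd : ε < d := hε.2.trans_le (min_le_right _ _)
  have hpos : 0 < ε ^ (1 + b) := Real.rpow_pos_of_pos hε0 _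
  have hI : ‖∫ u in r..(r + ε), u ^ a * ((s + ε - u) ^ b - (s - u) ^ b)‖ ≤
      2 ^ |a| * r ^ a * (|b| * d ^ (b - 1) * ε) * |r + ε - r| := by
    refine intervalIntegral.norm_integral_le_of_norm_le_const fun u hu ↦ ?_
    rw [Set.uIoc_of_le (by linarith)] at hu
    have hu0 : 0 ≤ u := by linarith [hu.1]
    rw [norm_mul, Real.norm_of_nonneg (Real.rpow_nonneg hu0 _), Real.norm_eq_abs,
      show s + ε - u = s - u + ε by ring]
    refine mul_le_mul (rpow_le_two_rpow_abs_mul hr hu.1.le (by linarith [hu.2]))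
      (abs_rpow_add_sub_rpow_le hb1 hd0 (by linarith [hu.2]) hε0.le) (abs_nonneg _) (by positivity)
  rw [add_sub_cancel_left, abs_of_pos hε0] at hI
  rw [incrementCov_of_add_le ha hb hε0.le hr.le (by linarith), norm_div, norm_mul,
    Real.norm_of_nonneg hpos.le, Real.norm_of_nonneg (by positivity), div_le_iff₀ hpos,
    mul_assoc M, ← Real.rpow_add hε0, show 1 - b + (1 + b) = (2 : ℕ) by norm_num,
    Real.rpow_natCast]
  calc _ ≤ 1 / (2 * beta (a + 1) (b + 1)) *
        (2 ^ |a| * r ^ a * (|b| * d ^ (b - 1) * ε) * ε) := by gcongr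
    _ = _ := by ring

lemma tendsto_incrementCov_of_ne (ha : -1 < a) (hb : -1 < b) (hb1 : b < 1) {r s : ℝ} (hr : 0 < r)
    (hs : 0 < s) (hrs : s ≠ r) :
    Tendsto (fun ε ↦ incrementCov a b ε s r / ε ^ (1 + b)) (𝓝[>] 0) (𝓝 0) := by
  rcases hrs.lt_or_gt with h | h
  · simp_rw [incrementCov_comm _ s r]
    exact tendsto_incrementCov_of_lt ha hb hb1 hs h
  · exact tendsto_incrementCov_of_lt ha hb hb1 hr h

end Covariance

/-! ### Fubini and second moments of integrals of random functions -/

section SecondMoment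

variable {α Ω : Type*} [MeasurableSpace α] [MeasurableSpace Ω] {ν : Measure α} {P : Measure Ω}
  {Z : α → Ω → ℝ} {g : α → ℝ}

lemma integral_abs_le_of_integral_sq_le [IsProbabilityMeasure P] {U : Ω → ℝ} (hU : MemLp U 2 P)
    {c : ℝ} (hc : 0 ≤ c)
    (h : ∫ ω, U ω ^ 2 ∂P ≤ c ^ 2) : ∫ ω, |U ω| ∂P ≤ c := by
  have h1 := sq_integral_mul_le hU.abs (memLp_const (1 : ℝ))
  simp only [mul_one, one_pow, sq_abs, integral_const, probReal_univ, smul_eq_mul, Pi.abs_apply]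
    at h1
  exact abs_le_of_sq_le_sq' (h1.trans h) hc |>.2

lemma integral_abs_mul_le {U V : Ω → ℝ} (hU : MemLp U 2 P) (hV : MemLp V 2 P) {c d : ℝ}
    (hc : 0 ≤ c) (hd : 0 ≤ d) (h : ∫ ω, U ω ^ 2 ∂P ≤ c ^ 2) (h' : ∫ ω, V ω ^ 2 ∂P ≤ d ^ 2) :
    ∫ ω, |U ω * V ω| ∂P ≤ c * d := by
  have h1 := sq_integral_mul_le hU.abs hV.abs
  simp only [sq_abs, Pi.abs_apply, ← abs_mul] at h1
  refine abs_le_of_sq_le_sq' (h1.trans ?_) (mul_nonneg hc hd) |>.2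
  rw [mul_pow]
  exact mul_le_mul h h' (integral_nonneg fun _ ↦ sq_nonneg _) (sq_nonneg _)

/-- The `L¹(P)` norm of `Z s` is at most its `L²(P)` norm, hence at most `g s`; Tonelli concludes.
-/
lemma integrable_prod_of_integral_sq_le [IsProbabilityMeasure P]
    (hZ : AEStronglyMeasurable (fun p : α × Ω ↦ Z p.1 p.2) (ν.prod P)) (hg : Integrable g ν)
    (hg0 : ∀ s, 0 ≤ g s) (hL : ∀ᵐ s ∂ν, MemLp (Z s) 2 P ∧ ∫ ω, Z s ω ^ 2 ∂P ≤ g s ^ 2) :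
    Integrable (fun p : α × Ω ↦ Z p.1 p.2) (ν.prod P) := by
  refine (integrable_prod_iff hZ).2 ⟨?_, hg.mono' hZ.norm.integral_prod_right' ?_⟩
  · filter_upwards [hL] with s hs using hs.1.integrable (by norm_num)
  · filter_upwards [hL] with s hs
    rw [Real.norm_of_nonneg (integral_nonneg fun _ ↦ norm_nonneg _)]
    exact integral_abs_le_of_integral_sq_le hs.1 (hg0 s) hs.2

lemma aestronglyMeasurable_mul_prod [SFinite ν] [SFinite P]
    (hZ : AEStronglyMeasurable (fun p : α × Ω ↦ Z p.1 p.2) (ν.prod P)) :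
    AEStronglyMeasurable (fun p : (α × α) × Ω ↦ Z p.1.1 p.2 * Z p.1.2 p.2)
      ((ν.prod ν).prod P) := by
  have h1 : Measure.QuasiMeasurePreserving (Prod.map Prod.fst id : (α × α) × Ω → α × Ω)
      ((ν.prod ν).prod P) (ν.prod P) :=
    QuasiMeasurePreserving.prodMap Measure.quasiMeasurePreserving_fst
      (Measure.QuasiMeasurePreserving.id P)
  have h2 : Measure.QuasiMeasurePreserving (Prod.map Prod.snd id : (α × α) × Ω → α × Ω)
      ((ν.prod ν).prod P) (ν.prod P) :=
    QuasiMeasurePreserving.prodMap Measure.quasiMeasurePreserving_snd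
      (Measure.QuasiMeasurePreserving.id P)
  exact (hZ.comp_quasiMeasurePreserving h1).mul (hZ.comp_quasiMeasurePreserving h2)

/-- Cauchy–Schwarz bounds `E|Z s * Z r|` by `g s * g r`, which is integrable for the product
measure. This justifies the exchange of integrals in the second-moment formula. -/
lemma integrable_mul_prod_of_integral_sq_le [SFinite ν] [IsProbabilityMeasure P]
    (hZ : AEStronglyMeasurable (fun p : α × Ω ↦ Z p.1 p.2) (ν.prod P)) (hg : Integrable g ν)
    (hg0 : ∀ s, 0 ≤ g s) (hL : ∀ᵐ s ∂ν, MemLp (Z s) 2 P ∧ ∫ ω, Z s ω ^ 2 ∂P ≤ g s ^ 2) :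
    Integrable (fun p : (α × α) × Ω ↦ Z p.1.1 p.2 * Z p.1.2 p.2) ((ν.prod ν).prod P) := by
  have hm := aestronglyMeasurable_mul_prod hZ
  have h1 := (Measure.quasiMeasurePreserving_fst (μ := ν) (ν := ν)).ae hL
  have h2 := (Measure.quasiMeasurePreserving_snd (μ := ν) (ν := ν)).ae hL
  refine (integrable_prod_iff hm).2
    ⟨?_, (hg.mul_prod hg).mono' hm.norm.integral_prod_right' ?_⟩
  · filter_upwards [h1, h2] with q hq1 hq2 using hq1.1.integrable_mul hq2.1
  · filter_upwards [h1, h2] with q hq1 hq2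
    rw [Real.norm_of_nonneg (integral_nonneg fun _ ↦ norm_nonneg _)]
    exact integral_abs_mul_le hq1.1 hq2.1 (hg0 _) (hg0 _) hq1.2 hq2.2

/-- The second moment of the integral of a random function is the double integral of its
covariances. -/
lemma memLp_integral_and_integral_sq [SFinite ν] [IsProbabilityMeasure P]
    (hZ : AEStronglyMeasurable (fun p : α × Ω ↦ Z p.1 p.2) (ν.prod P)) (hg : Integrable g ν)
    (hg0 : ∀ s, 0 ≤ g s) (hL : ∀ᵐ s ∂ν, MemLp (Z s) 2 P ∧ ∫ ω, Z s ω ^ 2 ∂P ≤ g s ^ 2) :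
    MemLp (fun ω ↦ ∫ s, Z s ω ∂ν) 2 P ∧
    ∫ ω, (∫ s, Z s ω ∂ν) ^ 2 ∂P = ∫ q : α × α, ∫ ω, Z q.1 ω * Z q.2 ω ∂P ∂(ν.prod ν) := by
  have hi := integrable_mul_prod_of_integral_sq_le hZ hg hg0 hL
  have hsq : ∀ ω, ∫ q : α × α, Z q.1 ω * Z q.2 ω ∂(ν.prod ν) = (∫ s, Z s ω ∂ν) ^ 2 := fun ω ↦ by
    rw [integral_prod_mul (fun s ↦ Z s ω) (fun s ↦ Z s ω), sq]
  constructor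
  · refine (memLp_two_iff_integrable_sq ?_).2 ?_
    · exact hZ.prod_swap.integral_prod_right'
    · simpa only [hsq] using hi.integral_prod_right
  · rw [integral_integral_swap (f := fun (q : α × α) ω ↦ Z q.1 ω * Z q.2 ω) hi]
    simp only [hsq]

end SecondMoment

/-! ### Gaussian structure and joint measurability of the increments of `B` -/

section Increments

variable {Ω : Type*} [MeasurableSpace Ω] {P : Measure Ω} {a b : ℝ} {B : ℝ → Ω → ℝ}

lemma IsWeightedFBm.hasGaussianLaw_eval (hB : IsWeightedFBm a b P B) {s : ℝ} (hs : 0 ≤ s) :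
    HasGaussianLaw (B s) P := hB.gaussian.hasGaussianLaw_eval ⟨s, hs⟩

lemma IsWeightedFBm.hasGaussianLaw_increments (hB : IsWeightedFBm a b P B) {ε s r : ℝ}
    (hε : 0 ≤ ε) (hs : 0 ≤ s) (hr : 0 ≤ r) :
    HasGaussianLaw (fun ω ↦ (B (s + ε) ω - B s ω, B (r + ε) ω - B r ω)) P := by
  classical
  have h : IsGaussianProcess (fun (t : ℝ≥0) ω ↦ B (t + ε) ω - B t ω) P :=
    -- Each increment is a linear function of two coordinates of `B`, namely those at `t + ε` and
    -- `t`.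
    hB.gaussian.of_isGaussianProcess fun t ↦ ⟨{t + ⟨ε, hε⟩, t},
      ContinuousLinearMap.proj ⟨t + ⟨ε, hε⟩, by simp⟩ - ContinuousLinearMap.proj ⟨t, by simp⟩,
      fun ω ↦ rfl⟩
  exact h.hasGaussianLaw_prodMk (s := ⟨s, hs⟩) (t := ⟨r, hr⟩)

lemma IsWeightedFBm.integral_increment (hB : IsWeightedFBm a b P B) {ε s : ℝ}
    (hε : 0 ≤ ε) (hs : 0 ≤ s) : ∫ ω, (B (s + ε) ω - B s ω) ∂P = 0 := by
  have hsε : 0 ≤ s + ε := by linarith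
  rw [integral_sub (hB.hasGaussianLaw_eval hsε).integrable (hB.hasGaussianLaw_eval hs).integrable,
    hB.mean_zero _ hsε, hB.mean_zero _ hs, sub_zero]

lemma IsWeightedFBm.integral_increment_mul (hB : IsWeightedFBm a b P B) {ε s r : ℝ}
    (hε : 0 ≤ ε) (hs : 0 ≤ s) (hr : 0 ≤ r) :
    ∫ ω, (B (s + ε) ω - B s ω) * (B (r + ε) ω - B r ω) ∂P = incrementCov a b ε s r := by
  have hsε : 0 ≤ s + ε := by linarith
  have hrε : 0 ≤ r + ε := by linarith
  have hi : ∀ {x y : ℝ}, 0 ≤ x → 0 ≤ y → Integrable (fun ω ↦ B x ω * B y ω) P := fun hx hy ↦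
    (hB.hasGaussianLaw_eval hx).memLp_two.integrable_mul (hB.hasGaussianLaw_eval hy).memLp_two
  have e : ∀ ω, (B (s + ε) ω - B s ω) * (B (r + ε) ω - B r ω) =
      B (s + ε) ω * B (r + ε) ω - B (s + ε) ω * B r ω - B s ω * B (r + ε) ω + B s ω * B r ω :=
    fun ω ↦ by ring
  simp_rw [e]
  rw [integral_add (((hi hsε hrε).sub' (hi hsε hr)).sub' (hi hs hrε)) (hi hs hr),
    integral_sub ((hi hsε hrε).sub' (hi hsε hr)) (hi hs hrε),
    integral_sub (hi hsε hrε) (hi hsε hr), hB.cov _ _ hsε hrε, hB.cov _ _ hsε hr,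
    hB.cov _ _ hs hrε, hB.cov _ _ hs hr, incrementCov]

lemma IsWeightedFBm.integral_increment_sq (hB : IsWeightedFBm a b P B) {ε s : ℝ}
    (hε : 0 ≤ ε) (hs : 0 ≤ s) :
    ∫ ω, (B (s + ε) ω - B s ω) ^ 2 ∂P = incrementCov a b ε s s := by
  simp_rw [sq]
  exact hB.integral_increment_mul hε hs hs

lemma IsWeightedFBm.sq_incrementCov_le (hB : IsWeightedFBm a b P B) {ε s r : ℝ}
    (hε : 0 ≤ ε) (hs : 0 ≤ s) (hr : 0 ≤ r) :
    incrementCov a b ε s r ^ 2 ≤ incrementCov a b ε s s * incrementCov a b ε r r := by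
  have h := hB.hasGaussianLaw_increments hε hs hr
  have := sq_integral_mul_le h.fst.memLp_two h.snd.memLp_two
  rwa [hB.integral_increment_mul hε hs hr, hB.integral_increment_sq hε hs,
    hB.integral_increment_sq hε hr] at this

lemma IsWeightedFBm.integral_centred_mul [IsProbabilityMeasure P] (hB : IsWeightedFBm a b P B)
    {ε s r : ℝ} (hε : 0 ≤ ε) (hs : 0 ≤ s) (hr : 0 ≤ r) :
    ∫ ω, ((B (s + ε) ω - B s ω) ^ 2 - incrementCov a b ε s s) *
      ((B (r + ε) ω - B r ω) ^ 2 - incrementCov a b ε r r) ∂P =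
      2 * incrementCov a b ε s r ^ 2 := by
  have := integral_centred_sq_mul_sq (hB.hasGaussianLaw_increments hε hs hr)
    (hB.integral_increment hε hs) (hB.integral_increment hε hr)
  rwa [hB.integral_increment_mul hε hs hr, hB.integral_increment_sq hε hs,
    hB.integral_increment_sq hε hr] at this

lemma IsWeightedFBm.memLp_centred [IsProbabilityMeasure P] (hB : IsWeightedFBm a b P B)
    {ε s : ℝ} (hε : 0 ≤ ε) (hs : 0 ≤ s) (c : ℝ) :
    MemLp (fun ω ↦ (B (s + ε) ω - B s ω) ^ 2 - c) 2 P := by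
  have h := (hB.hasGaussianLaw_increments hε hs hs).fst
  have h4 : MemLp (fun ω ↦ B (s + ε) ω - B s ω) (2 * 2) P := h.memLp (by norm_num)
  refine MemLp.sub ?_ (memLp_const c)
  simp_rw [sq]
  -- Hölder with `1/4 + 1/4 = 1/2`: a product of two `L⁴` functions lies in `L²`.
  have : ENNReal.HolderTriple (2 * 2) (2 * 2) 2 := ⟨by
    rw [← two_mul, ENNReal.mul_inv (by norm_num) (by norm_num), ← mul_assoc,
      ENNReal.mul_inv_cancel (by norm_num) (by norm_num), one_mul]⟩
  exact h4.mul h4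

lemma aestronglyMeasurable_increment
    (hmeas : AEMeasurable (fun p : ℝ × Ω ↦ B p.1 p.2)
      ((volume.restrict (Set.Ici (0 : ℝ))).prod P)) [SFinite P] {ε : ℝ} (hε : 0 ≤ ε) :
    AEStronglyMeasurable (fun p : ℝ × Ω ↦ B (p.1 + ε) p.2 - B p.1 p.2)
      ((volume.restrict (Set.Ioi (0 : ℝ))).prod P) := by
  have h : ∀ δ : ℝ, 0 ≤ δ → AEStronglyMeasurable (fun p : ℝ × Ω ↦ B (p.1 + δ) p.2)
      ((volume.restrict (Set.Ioi (0 : ℝ))).prod P) := by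
    intro δ hδ
    -- Measurability of `B` holds only up to a null set of the half-line; translation by `δ ≥ 0`
    -- keeps the half-line and pulls null sets back to null sets.
    have hq : Measure.QuasiMeasurePreserving (fun s : ℝ ↦ s + δ)
        (volume.restrict (Set.Ioi (0 : ℝ))) (volume.restrict (Set.Ici (0 : ℝ))) :=
      (measurePreserving_add_right volume δ).quasiMeasurePreserving.restrict
        fun s hs ↦ (add_nonneg (Set.mem_Ioi.1 hs).le hδ : 0 ≤ s + δ)
    exact hmeas.aestronglyMeasurable.comp_quasiMeasurePreserving
      (QuasiMeasurePreserving.prodMap hq (Measure.QuasiMeasurePreserving.id P))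
  have h0 := h 0 le_rfl
  simp only [add_zero] at h0
  exact (h ε hε).sub h0

end Increments

/-! ### Deterministic weights, domination and pointwise limits -/

section Weight

variable {a b : ℝ}

/-- The deterministic weight against which the squared increments are integrated. -/
noncomputable def weight (a b ε t : ℝ) : ℝ → ℝ :=
  Set.indicator (Set.Ioc ε (t + ε)) fun s ↦ (1 + a + b) / ε ^ (1 + b) * s ^ b

/-- An integrable function dominating the weighted variances of the increments. -/
noncomputable def dominant (a b T : ℝ) : ℝ → ℝ :=
  Set.indicator (Set.Ioc 0 T) fun s ↦ (1 + a + b) * kappa a b * 2 ^ |a| * s ^ (a + b)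

lemma kappa_pos (ha : -1 < a) (hb : -1 < b) : 0 < kappa a b := by
  have hβ := beta_pos (by linarith : 0 < a + 1) (by linarith : 0 < b + 1)
  have hb1 : 0 < 1 + b := by linarith
  rw [kappa]
  positivity

lemma measurable_weight (ε t : ℝ) : Measurable (weight a b ε t) :=
  Measurable.indicator (by fun_prop) measurableSet_Ioc

lemma weight_nonneg (hab : 0 < 1 + a + b) {ε : ℝ} (hε : 0 < ε) (t s : ℝ) :
    0 ≤ weight a b ε t s := by
  refine Set.indicator_nonneg (fun s hs ↦ ?_) s
  have : 0 < s := hε.trans hs.1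
  positivity

lemma dominant_nonneg (ha : -1 < a) (hb : -1 < b) (hab : 0 < 1 + a + b) (T s : ℝ) :
    0 ≤ dominant a b T s := by
  refine Set.indicator_nonneg (fun s hs ↦ ?_) s
  have : 0 < s := hs.1
  have := kappa_pos ha hb
  positivity

lemma integrable_dominant (hab : 0 < 1 + a + b) {T : ℝ} (hT : 0 ≤ T) :
    Integrable (dominant a b T) := by
  refine (integrable_indicator_iff measurableSet_Ioc).2 ?_
  have h := intervalIntegral.intervalIntegrable_rpow' (a := 0) (b := T)
    (by linarith : -1 < a + b)
  rw [intervalIntegrable_iff, Set.uIoc_of_le hT] at h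
  exact Integrable.const_mul h _

/-- The power `ε ^ (1 + b)` in the variance cancels the normalisation, so the bound does not depend
on `ε` as long as `t + ε ≤ T`. -/
lemma weight_mul_incrementCov_le (ha : -1 < a) (hb : -1 < b) (hab : 0 < 1 + a + b) {ε t T : ℝ}
    (hε : 0 < ε) (hT : t + ε ≤ T) (s : ℝ) :
    weight a b ε t s * incrementCov a b ε s s ≤ dominant a b T s := by
  by_cases hs : s ∈ Set.Ioc ε (t + ε)
  · have hs0 : 0 < s := hε.trans hs.1
    have hpos : 0 < ε ^ (1 + b) := Real.rpow_pos_of_pos hε _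
    rw [weight, Set.indicator_of_mem hs, dominant,
      Set.indicator_of_mem (show s ∈ Set.Ioc 0 T from ⟨hs0, hs.2.trans hT⟩)]
    calc _ ≤ (1 + a + b) / ε ^ (1 + b) * s ^ b *
          (kappa a b * 2 ^ |a| * s ^ a * ε ^ (1 + b)) := by
          gcongr
          exact incrementCov_self_le ha hb hε hs.1.le
      _ = _ := by rw [Real.rpow_add hs0]; field_simp
  · rw [weight, Set.indicator_of_notMem hs, zero_mul]
    exact dominant_nonneg ha hb hab T s

/-- The expectation of `X_ε(t)`. -/
noncomputable def meanApprox (a b ε t : ℝ) : ℝ :=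
  ∫ s in Set.Ioi (0 : ℝ), weight a b ε t s * incrementCov a b ε s s

lemma tendsto_weight_mul_incrementCov (ha : -1 < a) (hb : -1 < b) {t s : ℝ} (hs : 0 < s) :
    Tendsto (fun ε ↦ weight a b ε t s * incrementCov a b ε s s) (𝓝[>] 0)
      (𝓝 (Set.indicator (Set.Ioc 0 t) (fun s ↦ (1 + a + b) * kappa a b * s ^ (a + b)) s)) := by
  rcases le_or_gt s t with hst | hst
  · rw [Set.indicator_of_mem (show s ∈ Set.Ioc 0 t from ⟨hs, hst⟩)]
    have h := (tendsto_incrementCov_self ha hb hs).const_mul ((1 + a + b) * s ^ b)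
    rw [show (1 + a + b) * kappa a b * s ^ (a + b) =
      (1 + a + b) * s ^ b * (kappa a b * s ^ a) by rw [Real.rpow_add hs]; ring]
    refine h.congr' ?_
    -- A point `s ≤ t` enters the window `(ε, t + ε]` once `ε < s`; in the other case, `s > t`
    -- leaves it once `ε < s - t`.
    filter_upwards [Ioo_mem_nhdsGT hs] with ε hε
    have : s ∈ Set.Ioc ε (t + ε) := ⟨hε.2, by linarith [hε.1]⟩
    rw [weight, Set.indicator_of_mem this]
    ring
  · rw [Set.indicator_of_notMem fun h ↦ absurd h.2 (not_le.2 hst)]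
    refine tendsto_const_nhds.congr' ?_
    filter_upwards [Ioo_mem_nhdsGT (sub_pos.2 hst)] with ε hε
    rw [weight, Set.indicator_of_notMem (fun h ↦ by linarith [h.2, hε.2]), zero_mul]

/-- The two weights contribute `ε ^ (1 + b)` twice in the denominator, exactly what normalises the
squared covariance in `tendsto_incrementCov_of_ne`. -/
lemma tendsto_weight_mul_sq_incrementCov (ha : -1 < a) (hb : -1 < b) (hb1 : b < 1)
    (hab : 0 < 1 + a + b) {t s r : ℝ} (hs : 0 < s) (hr : 0 < r) (hsr : s ≠ r) :
    Tendsto (fun ε ↦ weight a b ε t s * weight a b ε t r * (2 * incrementCov a b ε s r ^ 2))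
      (𝓝[>] 0) (𝓝 0) := by
  have h := ((tendsto_incrementCov_of_ne ha hb hb1 hr hs hsr).pow 2).const_mul
    (2 * (1 + a + b) ^ 2 * s ^ b * r ^ b)
  rw [zero_pow two_ne_zero, mul_zero] at h
  have hle : ∀ {ε x : ℝ}, 0 < ε → 0 < x →
      weight a b ε t x ≤ (1 + a + b) / ε ^ (1 + b) * x ^ b := fun {ε x} hε hx ↦
    Set.indicator_apply_le' (fun _ ↦ le_rfl) fun _ ↦ by positivity
  refine squeeze_zero' ?_ ?_ h
  · filter_upwards [self_mem_nhdsWithin] with ε hε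
    have h1 := weight_nonneg hab hε t s
    have h2 := weight_nonneg hab hε t r
    positivity
  · filter_upwards [self_mem_nhdsWithin] with ε hε
    have h1 := weight_nonneg hab hε t s
    have h2 := weight_nonneg hab hε t r
    have hε0 : 0 < ε := hε
    calc _ ≤ ((1 + a + b) / ε ^ (1 + b) * s ^ b) * ((1 + a + b) / ε ^ (1 + b) * r ^ b) *
          (2 * incrementCov a b ε s r ^ 2) := by
          gcongr
          · exact hle hε hs
          · exact hle hε hr
      _ = _ := by ring

lemma setIntegral_rpow (hab : 0 < 1 + a + b) {t : ℝ} (ht : 0 ≤ t) :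
    ∫ s in Set.Ioi (0 : ℝ),
      Set.indicator (Set.Ioc 0 t) (fun s ↦ (1 + a + b) * kappa a b * s ^ (a + b)) s =
      kappa a b * t ^ (1 + a + b) := by
  rw [setIntegral_indicator measurableSet_Ioc,
    Set.inter_eq_right.2 Set.Ioc_subset_Ioi_self, ← intervalIntegral.integral_of_le ht,
    intervalIntegral.integral_const_mul, integral_rpow (Or.inl (by linarith)),
    Real.zero_rpow (by linarith), show a + b + 1 = 1 + a + b by ring]
  field_simp
  ring

end Weight

/-! ### Convergence in `L²`: mean and variance -/

section Approximation

variable {Ω : Type*} {a b : ℝ} {B : ℝ → Ω → ℝ}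

/-- Moving the limits of integration into the weight gives a domain independent of `ε`, as dominated
convergence requires. -/
lemma sqApprox_eq_setIntegral {ε t : ℝ} (hε : 0 < ε) (ht : 0 ≤ t) (ω : Ω) :
    sqApprox a b B ε t ω =
      ∫ s in Set.Ioi (0 : ℝ), weight a b ε t s * (B (s + ε) ω - B s ω) ^ 2 := by
  have e : ∀ s, weight a b ε t s * (B (s + ε) ω - B s ω) ^ 2 =
      Set.indicator (Set.Ioc ε (t + ε)) (fun s ↦ (1 + a + b) / ε ^ (1 + b) *
        ((B (s + ε) ω - B s ω) ^ 2 * s ^ b)) s := fun s ↦ by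
    by_cases hs : s ∈ Set.Ioc ε (t + ε)
    · rw [weight, Set.indicator_of_mem hs, Set.indicator_of_mem hs]; ring
    · rw [weight, Set.indicator_of_notMem hs, Set.indicator_of_notMem hs, zero_mul]
  simp_rw [e]
  rw [setIntegral_indicator measurableSet_Ioc,
    Set.inter_eq_right.2 (Set.Ioc_subset_Ioi_self.trans (Set.Ioi_subset_Ioi hε.le)),
    integral_const_mul, sqApprox, intervalIntegral.integral_of_le (by linarith)]

lemma approx_id_eq_sqApprox (ε t : ℝ) (ω : Ω) :
    approx a b B (fun x ↦ x) ε t ω = sqApprox a b B ε t ω := by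
  simp only [approx, sqApprox, integrand, sq]

/-- The weighted squared increment, minus its expectation. -/
noncomputable def centred (a b : ℝ) (B : ℝ → Ω → ℝ) (ε t s : ℝ) (ω : Ω) : ℝ :=
  weight a b ε t s * ((B (s + ε) ω - B s ω) ^ 2 - incrementCov a b ε s s)

variable [MeasurableSpace Ω] {P : Measure Ω} [IsProbabilityMeasure P]

lemma aestronglyMeasurable_incrementCov (hB : IsWeightedFBm a b P B)
    (hmeas : AEMeasurable (fun p : ℝ × Ω ↦ B p.1 p.2)
      ((volume.restrict (Set.Ici (0 : ℝ))).prod P)) {ε : ℝ} (hε : 0 ≤ ε) :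
    AEStronglyMeasurable (fun s ↦ incrementCov a b ε s s) (volume.restrict (Set.Ioi (0 : ℝ))) := by
  -- Measurability in `s` comes from reading the variance as a partial integral of a jointly
  -- measurable function.
  refine ((aestronglyMeasurable_increment hmeas hε).pow 2).integral_prod_right'.congr ?_
  filter_upwards [ae_restrict_mem measurableSet_Ioi] with s hs
  exact hB.integral_increment_sq hε (Set.mem_Ioi.1 hs).le

lemma aestronglyMeasurable_centred (hB : IsWeightedFBm a b P B)
    (hmeas : AEMeasurable (fun p : ℝ × Ω ↦ B p.1 p.2)
      ((volume.restrict (Set.Ici (0 : ℝ))).prod P)) {ε : ℝ} (hε : 0 ≤ ε) (t : ℝ) :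
    AEStronglyMeasurable (fun p : ℝ × Ω ↦ centred a b B ε t p.1 p.2)
      ((volume.restrict (Set.Ioi (0 : ℝ))).prod P) := by
  have h1 := (measurable_weight (a := a) (b := b) ε t).aestronglyMeasurable
    (μ := volume.restrict (Set.Ioi (0 : ℝ)))
  exact h1.comp_fst.mul (((aestronglyMeasurable_increment hmeas hε).pow 2).sub
    (aestronglyMeasurable_incrementCov hB hmeas hε).comp_fst)

lemma memLp_centred (hB : IsWeightedFBm a b P B) {ε s : ℝ} (hε : 0 ≤ ε) (hs : 0 ≤ s) (t : ℝ) :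
    MemLp (centred a b B ε t s) 2 P :=
  (hB.memLp_centred hε hs _).const_mul _

lemma integral_centred_mul_centred (hB : IsWeightedFBm a b P B) {ε s r : ℝ} (hε : 0 ≤ ε)
    (hs : 0 ≤ s) (hr : 0 ≤ r) (t : ℝ) :
    ∫ ω, centred a b B ε t s ω * centred a b B ε t r ω ∂P =
      weight a b ε t s * weight a b ε t r * (2 * incrementCov a b ε s r ^ 2) := by
  rw [← hB.integral_centred_mul hε hs hr, ← integral_const_mul]
  refine integral_congr_ae (ae_of_all _ fun ω ↦ ?_)
  simp only [centred]
  ring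

lemma ae_memLp_centred (ha : -1 < a) (hb : -1 < b) (hab : 0 < 1 + a + b)
    (hB : IsWeightedFBm a b P B) {ε : ℝ} (hε : 0 < ε) (t : ℝ) :
    ∀ᵐ s ∂(volume.restrict (Set.Ioi (0 : ℝ))), MemLp (centred a b B ε t s) 2 P ∧
      ∫ ω, centred a b B ε t s ω ^ 2 ∂P ≤ (2 * dominant a b (t + ε) s) ^ 2 := by
  filter_upwards [ae_restrict_mem measurableSet_Ioi] with s hs
  have hs0 : 0 ≤ s := (Set.mem_Ioi.1 hs).le
  refine ⟨memLp_centred hB hε.le hs0 t, ?_⟩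
  simp_rw [sq (centred a b B ε t s _)]
  rw [integral_centred_mul_centred hB hε.le hs0 hs0]
  have h1 := weight_mul_incrementCov_le ha hb hab hε le_rfl s (t := t)
  have h2 : 0 ≤ weight a b ε t s * incrementCov a b ε s s :=
    mul_nonneg (weight_nonneg hab hε t s) (incrementCov_self_nonneg ha hb hε.le hs0)
  -- With `x` the weighted variance and `d` the dominant, this is `2 x² ≤ (2 d)²`, from `0 ≤ x ≤ d`.
  nlinarith

lemma integrable_two_mul_dominant (hab : 0 < 1 + a + b) {T : ℝ} (hT : 0 ≤ T) :
    Integrable (fun s ↦ 2 * dominant a b T s) (volume.restrict (Set.Ioi (0 : ℝ))) :=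
  ((integrable_dominant hab hT).const_mul 2).restrict

lemma integrable_weight_mul_incrementCov (ha : -1 < a) (hb : -1 < b) (hab : 0 < 1 + a + b)
    (hB : IsWeightedFBm a b P B) (hmeas : AEMeasurable (fun p : ℝ × Ω ↦ B p.1 p.2)
      ((volume.restrict (Set.Ici (0 : ℝ))).prod P)) {ε t : ℝ} (hε : 0 < ε) (ht : 0 ≤ t) :
    IntegrableOn (fun s ↦ weight a b ε t s * incrementCov a b ε s s) (Set.Ioi 0) := by
  refine (integrable_dominant hab (by linarith : 0 ≤ t + ε)).restrict.mono'
    ((measurable_weight ε t).aestronglyMeasurable.mul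
      (aestronglyMeasurable_incrementCov hB hmeas hε.le)) ?_
  filter_upwards [ae_restrict_mem measurableSet_Ioi] with s hs
  rw [Real.norm_of_nonneg (mul_nonneg (weight_nonneg hab hε t s)
    (incrementCov_self_nonneg ha hb hε.le (Set.mem_Ioi.1 hs).le))]
  exact weight_mul_incrementCov_le ha hb hab hε le_rfl s

/-- Fubini makes almost every path of the centred integrand integrable; adding back its integrable
mean gives both the integrability and the decomposition. -/
lemma ae_integrable_weight_mul_sq (ha : -1 < a) (hb : -1 < b) (hab : 0 < 1 + a + b)
    (hB : IsWeightedFBm a b P B) (hmeas : AEMeasurable (fun p : ℝ × Ω ↦ B p.1 p.2)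
      ((volume.restrict (Set.Ici (0 : ℝ))).prod P)) {ε t : ℝ} (hε : 0 < ε) (ht : 0 ≤ t) :
    ∀ᵐ ω ∂P, IntegrableOn (fun s ↦ weight a b ε t s * (B (s + ε) ω - B s ω) ^ 2) (Set.Ioi 0) ∧
      sqApprox a b B ε t ω =
        (∫ s in Set.Ioi (0 : ℝ), centred a b B ε t s ω) + meanApprox a b ε t := by
  have hi := integrable_prod_of_integral_sq_le
    (aestronglyMeasurable_centred hB hmeas hε.le t)
    (integrable_two_mul_dominant hab (by linarith : 0 ≤ t + ε))
    (fun s ↦ mul_nonneg zero_le_two (dominant_nonneg ha hb hab _ s))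
    (ae_memLp_centred ha hb hab hB hε t)
  have hq := integrable_weight_mul_incrementCov ha hb hab hB hmeas hε ht
  filter_upwards [hi.prod_left_ae] with ω hω
  have e : ∀ s, weight a b ε t s * (B (s + ε) ω - B s ω) ^ 2 =
      centred a b B ε t s ω + weight a b ε t s * incrementCov a b ε s s := fun s ↦ by
    rw [centred]; ring
  rw [sqApprox_eq_setIntegral hε ht]
  simp_rw [e]
  exact ⟨hω.add hq, integral_add hω hq⟩

lemma memLp_integral_centred (ha : -1 < a) (hb : -1 < b) (hab : 0 < 1 + a + b)
    (hB : IsWeightedFBm a b P B) (hmeas : AEMeasurable (fun p : ℝ × Ω ↦ B p.1 p.2)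
      ((volume.restrict (Set.Ici (0 : ℝ))).prod P)) {ε t : ℝ} (hε : 0 < ε) (ht : 0 ≤ t) :
    MemLp (fun ω ↦ ∫ s in Set.Ioi (0 : ℝ), centred a b B ε t s ω) 2 P ∧
    ∫ ω, (∫ s in Set.Ioi (0 : ℝ), centred a b B ε t s ω) ^ 2 ∂P =
      ∫ q : ℝ × ℝ, ∫ ω, centred a b B ε t q.1 ω * centred a b B ε t q.2 ω ∂P
        ∂((volume.restrict (Set.Ioi (0 : ℝ))).prod (volume.restrict (Set.Ioi (0 : ℝ)))) :=
  memLp_integral_and_integral_sq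
    (aestronglyMeasurable_centred hB hmeas hε.le t)
    (integrable_two_mul_dominant hab (by linarith : 0 ≤ t + ε))
    (fun s ↦ mul_nonneg zero_le_two (dominant_nonneg ha hb hab _ s))
    (ae_memLp_centred ha hb hab hB hε t)

lemma memLp_sqApprox (ha : -1 < a) (hb : -1 < b) (hab : 0 < 1 + a + b)
    (hB : IsWeightedFBm a b P B) (hmeas : AEMeasurable (fun p : ℝ × Ω ↦ B p.1 p.2)
      ((volume.restrict (Set.Ici (0 : ℝ))).prod P)) {ε t : ℝ} (hε : 0 < ε) (ht : 0 ≤ t) :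
    MemLp (sqApprox a b B ε t) 2 P := by
  refine ((memLp_integral_centred ha hb hab hB hmeas hε ht).1.add
    (memLp_const (meanApprox a b ε t))).ae_eq ?_
  filter_upwards [ae_integrable_weight_mul_sq ha hb hab hB hmeas hε ht] with ω hω
  exact hω.2.symm

lemma tendsto_meanApprox (ha : -1 < a) (hb : -1 < b) (hab : 0 < 1 + a + b)
    (hB : IsWeightedFBm a b P B) (hmeas : AEMeasurable (fun p : ℝ × Ω ↦ B p.1 p.2)
      ((volume.restrict (Set.Ici (0 : ℝ))).prod P)) {t : ℝ} (ht : 0 ≤ t) :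
    Tendsto (fun ε ↦ meanApprox a b ε t) (𝓝[>] 0) (𝓝 (kappa a b * t ^ (1 + a + b))) := by
  rw [← setIntegral_rpow hab ht]
  refine tendsto_integral_filter_of_dominated_convergence (dominant a b (t + 1)) ?_ ?_
    (integrable_dominant hab (by linarith)).restrict ?_
  · filter_upwards [self_mem_nhdsWithin] with ε hε
    exact (integrable_weight_mul_incrementCov ha hb hab hB hmeas hε ht).aestronglyMeasurable
  · filter_upwards [Ioo_mem_nhdsGT one_pos] with ε hε
    filter_upwards [ae_restrict_mem measurableSet_Ioi] with s hs
    rw [Real.norm_of_nonneg (mul_nonneg (weight_nonneg hab hε.1 t s)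
      (incrementCov_self_nonneg ha hb hε.1.le (Set.mem_Ioi.1 hs).le))]
    exact weight_mul_incrementCov_le ha hb hab hε.1 (by linarith [hε.2]) s
  · filter_upwards [ae_restrict_mem measurableSet_Ioi] with s hs
    exact tendsto_weight_mul_incrementCov ha hb hs

lemma ae_prod_fst_ne_snd :
    ∀ᵐ q : ℝ × ℝ ∂((volume.restrict (Set.Ioi (0 : ℝ))).prod (volume.restrict (Set.Ioi (0 : ℝ)))),
      0 < q.1 ∧ 0 < q.2 ∧ q.1 ≠ q.2 := by
  have h : ∀ᵐ s ∂(volume.restrict (Set.Ioi (0 : ℝ))), 0 < s := ae_restrict_mem measurableSet_Ioi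
  have hms : MeasurableSet {q : ℝ × ℝ | q.1 ≠ q.2} :=
    (measurableSet_eq_fun measurable_fst measurable_snd).compl
  have hne : ∀ᵐ q : ℝ × ℝ ∂((volume.restrict (Set.Ioi (0 : ℝ))).prod
      (volume.restrict (Set.Ioi (0 : ℝ)))), q.1 ≠ q.2 := by
    refine (Measure.ae_prod_iff_ae_ae hms).2 (ae_of_all _ fun s ↦ ?_)
    filter_upwards [Measure.ae_ne (volume.restrict (Set.Ioi (0 : ℝ))) s] with r hr using hr.symm
  filter_upwards [Measure.quasiMeasurePreserving_fst.ae h,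
    Measure.quasiMeasurePreserving_snd.ae h, hne] with q h1 h2 h3 using ⟨h1, h2, h3⟩

lemma tendsto_integral_sq_integral_centred (ha : -1 < a) (hb : -1 < b) (hb1 : b < 1)
    (hab : 0 < 1 + a + b)
    (hB : IsWeightedFBm a b P B) (hmeas : AEMeasurable (fun p : ℝ × Ω ↦ B p.1 p.2)
      ((volume.restrict (Set.Ici (0 : ℝ))).prod P)) {t : ℝ} (ht : 0 ≤ t) :
    Tendsto (fun ε ↦ ∫ ω, (∫ s in Set.Ioi (0 : ℝ), centred a b B ε t s ω) ^ 2 ∂P)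
      (𝓝[>] 0) (𝓝 0) := by
  set ν := volume.restrict (Set.Ioi (0 : ℝ))
  have hd : Integrable (dominant a b (t + 1)) ν :=
    (integrable_dominant hab (by linarith)).restrict
  have hlim : Tendsto (fun ε ↦ ∫ q : ℝ × ℝ,
      ∫ ω, centred a b B ε t q.1 ω * centred a b B ε t q.2 ω ∂P ∂(ν.prod ν)) (𝓝[>] 0)
      (𝓝 (∫ _ : ℝ × ℝ, (0 : ℝ) ∂(ν.prod ν))) := by
    refine tendsto_integral_filter_of_dominated_convergence
      (fun q ↦ 2 * (dominant a b (t + 1) q.1 * dominant a b (t + 1) q.2)) ?_ ?_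
      ((hd.mul_prod hd).const_mul 2) ?_
    · filter_upwards [self_mem_nhdsWithin] with ε hε
      exact (aestronglyMeasurable_mul_prod (aestronglyMeasurable_centred hB hmeas
        (Set.mem_Ioi.1 hε).le t)).integral_prod_right'
    · filter_upwards [Ioo_mem_nhdsGT one_pos] with ε hε
      filter_upwards [ae_prod_fst_ne_snd] with q hq
      have hε0 : 0 < ε := hε.1
      rw [integral_centred_mul_centred hB hε0.le hq.1.le hq.2.1.le]
      have w1 := weight_nonneg hab hε0 t q.1
      have w2 := weight_nonneg hab hε0 t q.2
      have c1 := incrementCov_self_nonneg ha hb hε0.le hq.1.le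
      have c2 := incrementCov_self_nonneg ha hb hε0.le hq.2.1.le
      have d1 := weight_mul_incrementCov_le ha hb hab hε0 (by linarith [hε.2] : t + ε ≤ t + 1) q.1
      have d2 := weight_mul_incrementCov_le ha hb hab hε0 (by linarith [hε.2] : t + ε ≤ t + 1) q.2
      rw [Real.norm_of_nonneg (by positivity)]
      -- Cauchy–Schwarz bounds the covariance by the two variances, decoupling the variables into a
      -- product of dominants.
      calc _ ≤ weight a b ε t q.1 * weight a b ε t q.2 *
            (2 * (incrementCov a b ε q.1 q.1 * incrementCov a b ε q.2 q.2)) := by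
            gcongr
            exact hB.sq_incrementCov_le hε0.le hq.1.le hq.2.1.le
        _ = 2 * ((weight a b ε t q.1 * incrementCov a b ε q.1 q.1) *
            (weight a b ε t q.2 * incrementCov a b ε q.2 q.2)) := by ring
        _ ≤ _ := by
            gcongr
            exact dominant_nonneg ha hb hab _ _
    · filter_upwards [ae_prod_fst_ne_snd] with q hq
      refine (tendsto_weight_mul_sq_incrementCov ha hb hb1 hab (t := t) hq.1 hq.2.1
        hq.2.2).congr' ?_
      filter_upwards [self_mem_nhdsWithin] with ε hε
      rw [integral_centred_mul_centred hB (Set.mem_Ioi.1 hε).le hq.1.le hq.2.1.le]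
  rw [integral_zero] at hlim
  refine hlim.congr' ?_
  filter_upwards [self_mem_nhdsWithin] with ε hε
  exact (memLp_integral_centred ha hb hab hB hmeas hε ht).2.symm

/-- Convergence of `X_ε(t)` in `L²`. -/
lemma tendsto_eLpNorm_sqApprox_sub (ha : -1 < a) (hb : -1 < b) (hb1 : b < 1)
    (hab : 0 < 1 + a + b)
    (hB : IsWeightedFBm a b P B) (hmeas : AEMeasurable (fun p : ℝ × Ω ↦ B p.1 p.2)
      ((volume.restrict (Set.Ici (0 : ℝ))).prod P)) {t : ℝ} (ht : 0 ≤ t) :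
    Tendsto (fun ε ↦ eLpNorm (fun ω ↦ sqApprox a b B ε t ω - kappa a b * t ^ (1 + a + b)) 2 P)
      (𝓝[>] 0) (𝓝 0) := by
  -- The random fluctuation `h1` and the deterministic bias `h2` are treated separately and
  -- recombined by Minkowski's inequality.
  have h1 : Tendsto (fun ε ↦ eLpNorm (fun ω ↦ ∫ s in Set.Ioi (0 : ℝ), centred a b B ε t s ω) 2 P)
      (𝓝[>] 0) (𝓝 0) := by
    have h := (ENNReal.continuous_ofReal.tendsto _).comp
      ((Real.continuous_sqrt.tendsto _).comp
        (tendsto_integral_sq_integral_centred ha hb hb1 hab hB hmeas ht))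
    rw [Real.sqrt_zero, ENNReal.ofReal_zero] at h
    refine h.congr' ?_
    filter_upwards [self_mem_nhdsWithin] with ε hε
    rw [(memLp_integral_centred ha hb hab hB hmeas hε ht).1.eLpNorm_eq_integral_rpow_norm
      (by norm_num) (by norm_num)]
    simp [Real.sqrt_eq_rpow]
  have h2 : Tendsto (fun ε ↦ ‖meanApprox a b ε t - kappa a b * t ^ (1 + a + b)‖ₑ)
      (𝓝[>] 0) (𝓝 0) := by
    have h := ((tendsto_meanApprox ha hb hab hB hmeas ht).sub_const
      (kappa a b * t ^ (1 + a + b))).enorm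
    simpa using h
  have h12 := h1.add h2
  rw [add_zero] at h12
  refine tendsto_of_tendsto_of_tendsto_of_le_of_le' tendsto_const_nhds h12
    (Eventually.of_forall fun _ ↦ zero_le) ?_
  filter_upwards [self_mem_nhdsWithin] with ε hε
  have hae : (fun ω ↦ sqApprox a b B ε t ω - kappa a b * t ^ (1 + a + b)) =ᵐ[P]
      (fun ω ↦ ∫ s in Set.Ioi (0 : ℝ), centred a b B ε t s ω) +
        fun _ ↦ meanApprox a b ε t - kappa a b * t ^ (1 + a + b) := by
    filter_upwards [ae_integrable_weight_mul_sq ha hb hab hB hmeas hε ht] with ω hω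
    rw [hω.2, Pi.add_apply]
    ring
  rw [eLpNorm_congr_ae hae]
  refine (eLpNorm_add_le (memLp_integral_centred ha hb hab hB hmeas hε ht).1.1
    aestronglyMeasurable_const (by norm_num)).trans ?_
  rw [eLpNorm_const _ (by norm_num) (IsProbabilityMeasure.ne_zero P)]
  simp

end Approximation

/-! ### From pointwise to uniform convergence for monotone processes -/

section UniformConvergence

variable {Ω : Type*} [MeasurableSpace Ω] {P : Measure Ω}

/-- Pointwise convergence in probability of nondecreasing processes to a continuous function is
uniform on compact intervals. -/
lemma tendsto_measure_iSup_of_monotoneOn {ι : Type*} {l : Filter ι} {F : ι → ℝ → Ω → ℝ}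
    {g : ℝ → ℝ} {T : ℝ} (hT : 0 ≤ T) (hg : ContinuousOn g (Set.Icc 0 T))
    (hF : ∀ᶠ i in l, ∀ᵐ ω ∂P, MonotoneOn (fun t ↦ F i t ω) (Set.Icc 0 T))
    (hp : ∀ t ∈ Set.Icc 0 T, ∀ δ : ℝ, 0 < δ →
      Tendsto (fun i ↦ P {ω | ENNReal.ofReal δ ≤ ‖F i t ω - g t‖ₑ}) l (𝓝 0))
    {δ : ℝ} (hδ : 0 < δ) :
    Tendsto (fun i ↦ P {ω | ENNReal.ofReal δ ≤ ⨆ t ∈ Set.Icc 0 T, ‖F i t ω - g t‖ₑ}) l (𝓝 0) := by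
  have hδ4 : 0 < δ / 4 := by positivity
  obtain ⟨η, hη, hgη⟩ := Metric.uniformContinuousOn_iff.1
    (isCompact_Icc.uniformContinuousOn_of_continuous hg) (δ / 4) hδ4
  have hη2 : 0 < η / 2 := by positivity
  -- Grid of mesh at most `η / 2`, capped at `T`. The `+ 2` in `N` makes room for the right
  -- neighbour `k + 1` when `t = T`.
  set τ : ℕ → ℝ := fun k ↦ min T (k * (η / 2)) with hτ
  have hτmem : ∀ k, τ k ∈ Set.Icc 0 T := fun k ↦ ⟨le_min hT (by positivity), min_le_left _ _⟩
  set N := ⌊T / (η / 2)⌋₊ + 2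
  have hbracket : ∀ t ∈ Set.Icc 0 T, ∃ k, k + 1 < N ∧ τ k ≤ t ∧ t ≤ τ (k + 1) ∧
      dist (g (τ k)) (g t) < δ / 4 ∧ dist (g (τ (k + 1))) (g t) < δ / 4 := by
    intro t ht
    have h0 : 0 ≤ t / (η / 2) := div_nonneg ht.1 hη2.le
    have h1 : (⌊t / (η / 2)⌋₊ : ℝ) * (η / 2) ≤ t := (le_div_iff₀ hη2).1 (Nat.floor_le h0)
    have h2 : t < (⌊t / (η / 2)⌋₊ + 1 : ℝ) * (η / 2) := (div_lt_iff₀ hη2).1 (Nat.lt_floor_add_one _)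
    have h3 : ⌊t / (η / 2)⌋₊ ≤ ⌊T / (η / 2)⌋₊ :=
      Nat.floor_le_floor (div_le_div_of_nonneg_right ht.2 hη2.le)
    have h4 : τ ⌊t / (η / 2)⌋₊ = ⌊t / (η / 2)⌋₊ * (η / 2) := min_eq_right (h1.trans ht.2)
    have h5 : t ≤ τ (⌊t / (η / 2)⌋₊ + 1) := le_min ht.2 (by push_cast; exact h2.le)
    have h6 : τ (⌊t / (η / 2)⌋₊ + 1) ≤ (⌊t / (η / 2)⌋₊ + 1 : ℝ) * (η / 2) :=
      (min_le_right _ _).trans (by push_cast; exact le_rfl)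
    refine ⟨⌊t / (η / 2)⌋₊, by omega, h4 ▸ h1, h5, hgη _ (hτmem _) _ ht ?_,
      hgη _ (hτmem _) _ ht ?_⟩
    · rw [Real.dist_eq, abs_lt, h4]
      constructor <;> linarith
    · rw [Real.dist_eq, abs_lt]
      constructor <;> linarith
  have hsum : Tendsto (fun i ↦ ∑ k ∈ Finset.range N,
      P {ω | ENNReal.ofReal (δ / 4) ≤ ‖F i (τ k) ω - g (τ k)‖ₑ}) l (𝓝 0) := by
    have := tendsto_finsetSum (Finset.range N) fun k _ ↦ hp (τ k) (hτmem k) (δ / 4) hδ4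
    simpa using this
  refine tendsto_of_tendsto_of_tendsto_of_le_of_le' tendsto_const_nhds hsum
    (Eventually.of_forall fun _ ↦ zero_le) ?_
  filter_upwards [hF] with i hi
  -- The supremum is over uncountably many times, so its event need not be measurable; only
  -- monotonicity and subadditivity of `P` as an outer measure are used.
  refine le_trans (measure_mono_ae ?_) (measure_biUnion_finset_le (Finset.range N)
    fun k ↦ {ω | ENNReal.ofReal (δ / 4) ≤ ‖F i (τ k) ω - g (τ k)‖ₑ})
  filter_upwards [hi] with ω hω hsup
  by_contra hnot
  have hlt : ∀ k < N, |F i (τ k) ω - g (τ k)| < δ / 4 := by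
    intro k hk
    by_contra h
    refine hnot (Set.mem_biUnion (Finset.mem_range.2 hk) ?_)
    change ENNReal.ofReal (δ / 4) ≤ _
    rw [Real.enorm_eq_ofReal_abs]
    exact ENNReal.ofReal_le_ofReal (not_lt.1 h)
  -- Monotonicity traps `F i t ω` between its values at the two neighbouring grid points: `δ / 4`
  -- for the error there plus `δ / 4` for the oscillation of `g`. The total `δ / 2` is strictly
  -- below `δ`.
  have hle : ⨆ t ∈ Set.Icc 0 T, ‖F i t ω - g t‖ₑ ≤ ENNReal.ofReal (δ / 2) := by
    refine iSup₂_le fun t ht ↦ ?_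
    obtain ⟨k, hk, hkt, htk, hg1, hg2⟩ := hbracket t ht
    have m1 : F i (τ k) ω ≤ F i t ω := hω (hτmem k) ht hkt
    have m2 : F i t ω ≤ F i (τ (k + 1)) ω := hω ht (hτmem (k + 1)) htk
    have l1 := abs_lt.1 (hlt k (by omega))
    have l2 := abs_lt.1 (hlt (k + 1) hk)
    rw [Real.dist_eq] at hg1 hg2
    have g1 := abs_lt.1 hg1
    have g2 := abs_lt.1 hg2
    rw [Real.enorm_eq_ofReal_abs]
    refine ENNReal.ofReal_le_ofReal (abs_le.2 ⟨?_, ?_⟩) <;> linarith [l1.1, l2.2, g1.1, g2.2]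
  have hsup' : ENNReal.ofReal δ ≤ ⨆ t ∈ Set.Icc 0 T, ‖F i t ω - g t‖ₑ := hsup
  exact absurd (hsup'.trans hle) (not_le.2 ((ENNReal.ofReal_lt_ofReal_iff hδ).2 (by linarith)))

end UniformConvergence

/-! ### The generalized quadratic covariation -/

section QuadraticCovariation

/-- The integrand is nonnegative. Integrability matters: a non-integrable function has integral `0`
by convention, which could break monotonicity. -/
lemma monotoneOn_approx {Ω : Type*} {a b : ℝ} {B : ℝ → Ω → ℝ} (hab : 0 < 1 + a + b)
    {ε : ℝ} (hε : 0 < ε) {ω : Ω}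
    (h : ∀ t : ℝ, 0 ≤ t → IntervalIntegrable (integrand b B (fun x ↦ x) ε ω) volume ε (t + ε)) :
    MonotoneOn (fun t ↦ approx a b B (fun x ↦ x) ε t ω) (Set.Ici 0) := by
  intro t ht u hu htu
  have ht0 : 0 ≤ t := ht
  have hpos : 0 < ε ^ (1 + b) := Real.rpow_pos_of_pos hε _
  refine mul_le_mul_of_nonneg_left ?_ (by positivity)
  refine intervalIntegral.integral_mono_interval le_rfl (by linarith) (by linarith) ?_ (h u hu)
  filter_upwards [ae_restrict_mem measurableSet_Ioc] with s hs
  exact mul_nonneg (mul_self_nonneg _) (Real.rpow_nonneg (hε.trans hs.1).le _)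

variable {Ω : Type*} [MeasurableSpace Ω] {P : Measure Ω} [IsProbabilityMeasure P] {a b : ℝ}
  {B : ℝ → Ω → ℝ}

lemma ae_intervalIntegrable_integrand (ha : -1 < a) (hb : -1 < b) (hab : 0 < 1 + a + b)
    (hB : IsWeightedFBm a b P B) (hmeas : AEMeasurable (fun p : ℝ × Ω ↦ B p.1 p.2)
      ((volume.restrict (Set.Ici (0 : ℝ))).prod P)) {ε : ℝ} (hε : 0 < ε) :
    ∀ᵐ ω ∂P, ∀ t : ℝ, 0 ≤ t →
      IntervalIntegrable (integrand b B (fun x ↦ x) ε ω) volume ε (t + ε) := by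
  -- Integer horizons give a single null set valid for all `t`, since the window for `t` lies in
  -- that for any `n ≥ t`.
  have h := ae_all_iff.2 fun n : ℕ ↦
    ae_integrable_weight_mul_sq ha hb hab hB hmeas hε (Nat.cast_nonneg n)
  have hpos : 0 < ε ^ (1 + b) := Real.rpow_pos_of_pos hε _
  filter_upwards [h] with ω hω t ht
  obtain ⟨n, hn⟩ := exists_nat_ge t
  rw [intervalIntegrable_iff, Set.uIoc_of_le (by linarith)]
  have h1 : IntegrableOn (fun s ↦ ((1 + a + b) / ε ^ (1 + b))⁻¹ *
      (weight a b ε n s * (B (s + ε) ω - B s ω) ^ 2)) (Set.Ioc ε (t + ε)) :=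
    ((hω n).1.mono_set (Set.Ioc_subset_Ioi_self.trans (Set.Ioi_subset_Ioi hε.le))).const_mul _
  refine h1.congr_fun (fun s hs ↦ ?_) measurableSet_Ioc
  have hs' : s ∈ Set.Ioc ε (n + ε) := ⟨hs.1, hs.2.trans (by linarith)⟩
  simp only [weight, Set.indicator_of_mem hs', integrand]
  field_simp

/-- Chebyshev's inequality of order `2` turns the `L²` convergence into convergence in probability.
-/
lemma tendsto_measure_approx_sub (ha : -1 < a) (hb : -1 < b) (hb1 : b < 1) (hab : 0 < 1 + a + b)
    (hB : IsWeightedFBm a b P B) (hmeas : AEMeasurable (fun p : ℝ × Ω ↦ B p.1 p.2)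
      ((volume.restrict (Set.Ici (0 : ℝ))).prod P)) {t δ : ℝ} (ht : 0 ≤ t) (hδ : 0 < δ) :
    Tendsto (fun ε ↦ P {ω | ENNReal.ofReal δ ≤
      ‖approx a b B (fun x ↦ x) ε t ω - kappa a b * t ^ (1 + a + b)‖ₑ}) (𝓝[>] 0) (𝓝 0) := by
  have hδ' : ENNReal.ofReal δ ≠ 0 := (ENNReal.ofReal_pos.2 hδ).ne'
  have h := ENNReal.Tendsto.const_mul (a := (ENNReal.ofReal δ)⁻¹ ^ 2)
    (ENNReal.Tendsto.pow (n := 2) (tendsto_eLpNorm_sqApprox_sub ha hb hb1 hab hB hmeas ht))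
    (Or.inr (ENNReal.pow_ne_top (ENNReal.inv_ne_top.2 hδ')))
  rw [zero_pow two_ne_zero, mul_zero] at h
  refine tendsto_of_tendsto_of_tendsto_of_le_of_le' tendsto_const_nhds h
    (Eventually.of_forall fun _ ↦ zero_le) ?_
  filter_upwards [self_mem_nhdsWithin] with ε hε
  simp_rw [approx_id_eq_sqApprox]
  have := meas_ge_le_mul_pow_eLpNorm_enorm P (p := 2) (by norm_num) (by norm_num)
    ((memLp_sqApprox ha hb hab hB hmeas hε ht).sub
      (memLp_const (kappa a b * t ^ (1 + a + b)))).1 hδ' (by simp)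
  rw [ENNReal.toReal_ofNat, ENNReal.rpow_ofNat, ENNReal.rpow_ofNat] at this
  exact this

end QuadraticCovariation

end WeightedFBm

theorem proposition3p2 {Ω : Type*} [MeasurableSpace Ω] (P : Measure Ω) [IsProbabilityMeasure P]
    (a b : ℝ) (ha : -1 < a) (hb : |b| < 1) (hab : |b| < 1 + a)
    (B : ℝ → Ω → ℝ) (hB : WeightedFBm.IsWeightedFBm a b P B)
    (hmeas : AEMeasurable (fun p : ℝ × Ω ↦ B p.1 p.2)
      ((volume.restrict (Set.Ici (0 : ℝ))).prod P)) :
    (∀ t : ℝ, 0 ≤ t →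
      (∀ ε : ℝ, 0 < ε → MemLp (WeightedFBm.sqApprox a b B ε t) 2 P) ∧
      Tendsto
        (fun ε : ℝ ↦ eLpNorm
          (fun ω ↦ WeightedFBm.sqApprox a b B ε t ω -
            WeightedFBm.kappa a b * t ^ (1 + a + b)) 2 P)
        (𝓝[>] 0) (𝓝 0)) ∧
    WeightedFBm.IsGenQuadCov a b P B (fun x ↦ x)
      (fun t _ ↦ WeightedFBm.kappa a b * t ^ (1 + a + b)) := by
  obtain ⟨hb0, hb1⟩ := abs_lt.1 hb
  have hab' : 0 < 1 + a + b := by linarith [(abs_lt.1 hab).1]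
  refine ⟨fun t ht ↦ ⟨fun ε hε ↦ WeightedFBm.memLp_sqApprox ha hb0 hab' hB hmeas hε ht,
    WeightedFBm.tendsto_eLpNorm_sqApprox_sub ha hb0 hb1 hab' hB hmeas ht⟩,
    ⟨fun ε hε ↦ WeightedFBm.ae_intervalIntegrable_integrand ha hb0 hab' hB hmeas hε,
    fun T hT δ hδ ↦ WeightedFBm.tendsto_measure_iSup_of_monotoneOn hT ?_ ?_
      (fun t ht δ hδ ↦ WeightedFBm.tendsto_measure_approx_sub ha hb0 hb1 hab' hB hmeas ht.1 hδ)
      hδ⟩⟩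
  · exact continuousOn_const.mul (continuousOn_id.rpow_const fun _ _ ↦ Or.inr hab'.le)
  · filter_upwards [self_mem_nhdsWithin] with ε hε
    filter_upwards [WeightedFBm.ae_intervalIntegrable_integrand ha hb0 hab' hB hmeas
      (Set.mem_Ioi.1 hε)] with ω hω
    exact (WeightedFBm.monotoneOn_approx hab' hε hω).mono Set.Icc_subset_Ici_self
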